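/- For $N\ge 1$ let $\langle\cdot\rangle_0$ denote expectation in the normalized Gaussian measure on complex $N\times N$ matrices $M$ with density proportional to $e^{-N\,\mathrm{Tr}(M^\dagger M)}$ with respect to Lebesgue measure. For a polynomial $O$ in the entries of $M$ and $M^\dagger$, let $\langle O\rangle$ be the formal power series in $\alpha,g_1,g_2,\dots$ obtained by expanding the exponential in $$\Big\langle O\; e^{N\sum_{k\ge1}\frac{g_k\alpha^k}{k}\mathrm{Tr}[(M^\dagger M)^k]}\Big\rangle_0$$ and averaging term by term, and set $$d_{p;(N)}=\frac1N\,\frac{1}{\langle 1\rangle}\,\big\langle \mathrm{Tr}[(M^\dagger M)^p]\big\rangle .$$ For every $p\ge 0$ and every finitely supported sequence $n=(n_1,n_2,\dots)$ of non-negative integers, the coefficient of $\alpha^{\sum_j jn_j}g_1^{n_1}g_2^{n_2}\cdots$ in $d_{p;(N)}$ converges as $N\to\infty$. Let $d_{p;n}$ be its limit, that is, the coefficient of this monomial in the planar function $d_p=\lim_{N\to\infty}d_{p;(N)}$. Then for all integers $p,q\ge1$ and all such $n$, $$\frac1p\,\frac1{n_p+1}\,d_{p;\,n+e_q}=\frac1q\,\frac1{n_q+1}\,d_{q;\,n+e_p},$$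 where $e_k$ is the sequence with $k$-th entry $1$ and all other entries $0$. -/

import Mathlib

open scoped Matrix Nat
open Filter Topology MeasureTheory

noncomputable section

namespace MatrixModel

/-- Square complex `N × N` matrices, as functions of two indices. The measure `volume` on this
type is the product Lebesgue measure over all complex entries. -/
abbrev Mat (N : ℕ) : Type := Fin N → Fin N → ℂ

/-- The trace invariant `Tr [(M† M)^p]`. -/
def trInv {N : ℕ} (p : ℕ) (M : Mat N) : ℂ :=
  Matrix.trace (((Matrix.of M)ᴴ * Matrix.of M) ^ p)

/-- The correlation `⟨O⟩₀` of the normalized Gaussian measure of weight `exp (- N Tr (M† M))`. -/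
def gaussAvg (N : ℕ) (O : Mat N → ℂ) : ℂ :=
  (∫ M : Mat N, O M * Complex.exp (-(N : ℂ) * trInv 1 M)) /
    ∫ M : Mat N, Complex.exp (-(N : ℂ) * trInv 1 M)

/-- The formal variables: `none` is the coupling constant `α`, and `some k` is `g_k`, `k ≥ 1`. -/
abbrev Coupling : Type := Option ℕ+

/-- `n₁ + 2 n₂ + 3 n₃ + ⋯`, the order in `α` of the monomial `g₁^n₁ g₂^n₂ ⋯`. -/
def order (n : ℕ+ →₀ ℕ) : ℕ := n.sum fun k nk => (k : ℕ) * nk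

/-- The perturbative expansion of the correlation `⟨O⟩` of the interacting model,
`⟨O exp (N ∑_{k ≥ 1} (g_k α^k / k) Tr [(M† M)^k])⟩₀`, as a formal power series in `α` and in all
the couplings `g_k`: the exponential is expanded and the Gaussian average is taken term by term,
`∑_n α^(n₁ + 2 n₂ + ⋯) ∏_k (1 / n_k!) (N g_k / k)^n_k ⟨O ∏_k Tr [(M† M)^k]^n_k⟩₀`. -/
def correlation (N : ℕ) (O : Mat N → ℂ) : MvPowerSeries Coupling ℂ := fun m =>
  if m none = order m.some then
    (m.some.prod fun k nk => ((N : ℂ) / (k : ℕ)) ^ nk / (nk ! : ℂ)) *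
      gaussAvg N fun M => O M * m.some.prod fun k nk => trInv (k : ℕ) M ^ nk
  else 0

/-- `d_{p;(N)} = (1/N) (1/⟨1⟩) ⟨Tr [(M† M)^p]⟩`, as a formal power series in `α` and the `g_k`. -/
def dN (N p : ℕ) : MvPowerSeries Coupling ℂ :=
  MvPowerSeries.C (1 / (N : ℂ)) * (correlation N fun _ => 1)⁻¹ * correlation N (trInv p)

/-- The exponent of the monomial `α^(n₁ + 2 n₂ + ⋯) g₁^n₁ g₂^n₂ ⋯`. -/
def expo (n : ℕ+ →₀ ℕ) : Coupling →₀ ℕ := n.optionElim (order n)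

/-- The coefficient of `α^(n₁ + 2 n₂ + ⋯) g₁^n₁ g₂^n₂ ⋯` in `d_{p;(N)}`. -/
def dNCoeff (N p : ℕ) (n : ℕ+ →₀ ℕ) : ℂ := MvPowerSeries.coeff (expo n) (dN N p)

/-- The coefficient of `α^(n₁ + 2 n₂ + ⋯) g₁^n₁ g₂^n₂ ⋯` in the planar one-vertex function
`d_p = lim_{N → ∞} d_{p;(N)}`. -/
def dCoeff (p : ℕ) (n : ℕ+ →₀ ℕ) : ℂ := limUnder atTop fun N : ℕ => dNCoeff N p n

end MatrixModel

end

noncomputable section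

namespace MatrixModel

open ComplexConjugate

/-! ### Gaussian moments on the complex plane -/

/-! The symmetry already holds at every finite `N`. With `α = 1`, differentiating in `g_k` inserts
`(N/k) Tr[(M†M)^k]` (`pderiv_polySeries`), so `d_{p;(N)}` is `p/N²` times the `g_p`-derivative of
`log⟨1⟩`, and the claim is the equality of its mixed second derivatives. Concretely, `∂/∂g_q` of the
normalized one-trace series is `N/q` times a connected two-trace correlation, symmetric in `p` and
`q` (`pderiv_normSeries`, `mul_coeff_normSeries_symm`). The variable `α` only records the order of a
monomial, and `graded_mul` lets it be dropped.

The analytic content is the existence of the limit. Gaussian integration by parts along the vector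
field `M (M†M)^p` gives the loop equations (`loop_equation`). Dividing by `⟨1⟩`, and trading
connected two-trace correlations for coupling derivatives of one-trace ones, closes them into a
recursion for the `d_{p;(N)}` alone, whose only explicit `N`-dependence is a factor `1/N²`
(`dNCoeff_succ`). Every term on its right has a smaller value of `p + order n`, so convergence
follows by induction (`exists_tendsto_dNCoeff`). -/

/-- The Gaussian integral of `z ^ m * conj z ^ l` with weight `exp (- b ‖z‖ ^ 2)`. -/
def planeMoment (b : ℝ) (m l : ℕ) : ℂ :=
  ∫ z : ℂ, z ^ m * conj z ^ l * Complex.exp (-(b : ℂ) * (conj z * z))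

theorem integral_norm_pow_mul_exp {b : ℝ} (hb : 0 < b) (m : ℕ) :
    ∫ z : ℂ, ‖z‖ ^ m * Real.exp (-b * ‖z‖ ^ 2) =
      Real.pi * b ^ (-((m : ℝ) + 2) / 2) * Real.Gamma (((m : ℝ) + 2) / 2) := by
  have h := Complex.integral_rpow_mul_exp_neg_mul_rpow (p := 2) (q := m) (b := b) (by norm_num)
    (by have : (0 : ℝ) ≤ m := m.cast_nonneg
        linarith) hb
  have h2 : (2 * Real.pi / 2 : ℝ) = Real.pi := by ring
  rw [h2] at h
  rw [← h]
  congr 1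
  ext z
  rw [Real.rpow_natCast, Real.rpow_ofNat]

theorem exp_neg_mul_conj_mul_self (b : ℝ) (z : ℂ) :
    Complex.exp (-(b : ℂ) * (conj z * z)) = (Real.exp (-b * ‖z‖ ^ 2) : ℂ) := by
  rw [← Complex.normSq_eq_conj_mul_self, Complex.normSq_eq_norm_sq]
  push_cast
  rfl

theorem integrable_norm_pow_mul_exp {b : ℝ} (hb : 0 < b) (m : ℕ) :
    Integrable fun z : ℂ => ‖z‖ ^ m * Real.exp (-b * ‖z‖ ^ 2) := by
  -- A non-integrable function has Bochner integral `0` by convention, so a nonzero closed form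
  -- proves integrability.
  refine Integrable.of_integral_ne_zero ?_
  rw [integral_norm_pow_mul_exp hb]
  have : 0 < Real.Gamma (((m : ℝ) + 2) / 2) := Real.Gamma_pos_of_pos (by positivity)
  positivity

theorem integrable_planeMoment {b : ℝ} (hb : 0 < b) (m l : ℕ) :
    Integrable fun z : ℂ => z ^ m * conj z ^ l * Complex.exp (-(b : ℂ) * (conj z * z)) := by
  refine (integrable_norm_pow_mul_exp hb (m + l)).mono' ?_ (ae_of_all _ fun z => le_of_eq ?_)
  · exact Continuous.aestronglyMeasurable (by fun_prop)
  · rw [exp_neg_mul_conj_mul_self, norm_mul, norm_mul, norm_pow, norm_pow, RCLike.norm_conj,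
      Complex.norm_real, Real.norm_of_nonneg (Real.exp_nonneg _), pow_add]

theorem planeMoment_self {b : ℝ} (hb : 0 < b) (m : ℕ) :
    planeMoment b m m = (Real.pi / b ^ (m + 1) * m ! : ℝ) := by
  have h : planeMoment b m m =
      ∫ z : ℂ, ((‖z‖ ^ (2 * m) * Real.exp (-b * ‖z‖ ^ 2) : ℝ) : ℂ) := by
    unfold planeMoment
    congr 1
    ext z
    rw [exp_neg_mul_conj_mul_self, ← mul_pow, Complex.mul_conj, Complex.normSq_eq_norm_sq]
    push_cast
    ring
  rw [h, integral_complex_ofReal, integral_norm_pow_mul_exp hb]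
  congr 1
  have h1 : (((2 * m : ℕ) : ℝ) + 2) / 2 = m + 1 := by push_cast; ring
  rw [neg_div, h1, Real.Gamma_nat_eq_factorial, Real.rpow_neg hb.le, ← Nat.cast_add_one,
    Real.rpow_natCast]
  ring

/-- Lebesgue measure and the weight are rotation invariant; the rotation by `π / (m - l)` multiplies
the integrand by `-1`. -/
theorem planeMoment_of_ne (b : ℝ) {m l : ℕ} (hml : m ≠ l) : planeMoment b m l = 0 := by
  have hsub : ((m : ℂ) - l) ≠ 0 := sub_ne_zero.2 (by exact_mod_cast hml)
  set t : ℝ := Real.pi / ((m : ℝ) - l) with ht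
  set c : Circle := Circle.exp t with hc
  have hcc : (c : ℂ) ^ m * conj (c : ℂ) ^ l = -1 := by
    have h1 : (c : ℂ) = Complex.exp (t * Complex.I) := by rw [hc, Circle.coe_exp]
    have h2 : conj (c : ℂ) = Complex.exp (-(t * Complex.I)) := by
      rw [h1, ← Complex.exp_conj]
      simp
    rw [h2, h1, ← Complex.exp_nat_mul, ← Complex.exp_nat_mul, ← Complex.exp_add,
      ← Complex.exp_pi_mul_I]
    congr 1
    rw [ht]
    push_cast
    field_simp
    ring
  have hone : conj (c : ℂ) * c = 1 := by
    rw [← Complex.normSq_eq_conj_mul_self, Circle.normSq_coe]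
    simp
  have key : planeMoment b m l = -planeMoment b m l := by
    have h := (rotation c).measurePreserving.integral_comp
      (rotation c).toHomeomorph.measurableEmbedding
      (fun z : ℂ => z ^ m * conj z ^ l * Complex.exp (-(b : ℂ) * (conj z * z)))
    unfold planeMoment
    rw [← integral_neg]
    refine h.symm.trans ?_
    congr 1
    ext z
    have h3 : conj ((c : ℂ) * z) * (c * z) = conj z * z := by
      rw [map_mul]
      linear_combination (conj z * z) * hone
    simp only [rotation_apply]
    rw [h3, map_mul, mul_pow, mul_pow]
    linear_combination (z ^ m * conj z ^ l * Complex.exp (-(b : ℂ) * (conj z * z))) * hcc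
  exact self_eq_neg.1 key

/-- This is integration by parts in one complex variable, read off from the explicit moments. For `m
= 0` the truncated `m - 1` is harmless because of the factor `m`. -/
theorem planeMoment_succ {b : ℝ} (hb : 0 < b) (m l : ℕ) :
    b * planeMoment b m (l + 1) = m * planeMoment b (m - 1) l := by
  rcases m with _ | m
  · rw [planeMoment_of_ne b (by omega)]
    simp
  · rcases eq_or_ne m l with rfl | h
    · rw [Nat.add_sub_cancel, planeMoment_self hb, planeMoment_self hb, Nat.factorial_succ]
      have : (b : ℂ) ≠ 0 := by exact_mod_cast hb.ne'
      push_cast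
      field_simp
      ring
    · rw [planeMoment_of_ne b (by omega), planeMoment_of_ne b (by omega)]
      simp

/-! ### Gaussian averages of polynomials in the matrix entries -/

/-- The variables `M i j` (left) and `conj (M i j)` (right). -/
abbrev Entry (N : ℕ) : Type := (Fin N × Fin N) ⊕ (Fin N × Fin N)

/-- The values of the matrix entries and of their conjugates. -/
def entryValue {N : ℕ} (M : Mat N) : Entry N → ℂ :=
  Sum.elim (fun x => M x.1 x.2) (fun x => conj (M x.1 x.2))

theorem trInv_one {N : ℕ} (M : Mat N) : trInv 1 M = ∑ i, ∑ j, conj (M i j) * M i j := by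
  simp only [trInv, pow_one, Matrix.trace, Matrix.diag, Matrix.mul_apply,
    Matrix.conjTranspose_apply, Matrix.of_apply]
  rw [Finset.sum_comm]
  rfl

/-- The weight factors over the entries, so Fubini reduces matrix averages of monomials to plane
moments. -/
theorem monomial_mul_weight {N : ℕ} (s : Entry N →₀ ℕ) (M : Mat N) :
    MvPolynomial.eval (entryValue M) (MvPolynomial.monomial s 1) *
        Complex.exp (-(N : ℂ) * trInv 1 M) =
      ∏ i, ∏ j, M i j ^ s (.inl (i, j)) * conj (M i j) ^ s (.inr (i, j)) *
        Complex.exp (-((N : ℝ) : ℂ) * (conj (M i j) * M i j)) := by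
  rw [trInv_one, MvPolynomial.eval_monomial, one_mul, Finsupp.prod_fintype _ _ (by simp),
    Fintype.prod_sum_type, ← Finset.prod_mul_distrib, Fintype.prod_prod_type, Finset.mul_sum,
    Complex.exp_sum, ← Finset.prod_mul_distrib]
  refine Finset.prod_congr rfl fun i _ => ?_
  rw [Finset.mul_sum, Complex.exp_sum, ← Finset.prod_mul_distrib]
  rfl

theorem integrable_monomial {N : ℕ} (hN : 0 < N) (s : Entry N →₀ ℕ) :
    Integrable fun M : Mat N => MvPolynomial.eval (entryValue M) (MvPolynomial.monomial s 1) *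
        Complex.exp (-(N : ℂ) * trInv 1 M) := by
  simp_rw [monomial_mul_weight]
  have hN' : (0 : ℝ) < N := by exact_mod_cast hN
  exact Integrable.fintype_prod fun i => Integrable.fintype_prod fun j =>
    integrable_planeMoment hN' _ _

theorem integral_monomial {N : ℕ} (s : Entry N →₀ ℕ) :
    ∫ M : Mat N, MvPolynomial.eval (entryValue M) (MvPolynomial.monomial s 1) *
        Complex.exp (-(N : ℂ) * trInv 1 M) =
      ∏ x : Fin N × Fin N, planeMoment N (s (.inl x)) (s (.inr x)) := by
  simp_rw [monomial_mul_weight]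
  rw [Fintype.prod_prod_type]
  refine (integral_fintype_prod_volume_eq_prod (fun (i : Fin N) (v : Fin N → ℂ) =>
    ∏ j, v j ^ s (.inl (i, j)) * conj (v j) ^ s (.inr (i, j)) *
        Complex.exp (-((N : ℝ) : ℂ) * (conj (v j) * v j)))).trans ?_
  refine Finset.prod_congr rfl fun i _ => ?_
  exact integral_fintype_prod_volume_eq_prod (fun (j : Fin N) (z : ℂ) =>
    z ^ s (.inl (i, j)) * conj z ^ s (.inr (i, j)) *
        Complex.exp (-((N : ℝ) : ℂ) * (conj z * z)))

theorem integrable_polynomial {N : ℕ} (hN : 0 < N) (P : MvPolynomial (Entry N) ℂ) :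
    Integrable fun M : Mat N => MvPolynomial.eval (entryValue M) P *
        Complex.exp (-(N : ℂ) * trInv 1 M) := by
  induction P using MvPolynomial.induction_on' with
  | monomial s a =>
    refine ((integrable_monomial hN s).const_mul a).congr (ae_of_all _ fun M => ?_)
    simp only [MvPolynomial.eval_monomial]
    ring
  | add P Q hP hQ =>
    refine (hP.add hQ).congr (ae_of_all _ fun M => ?_)
    simp only [Pi.add_apply, map_add]
    ring

/-- The Gaussian average as a linear form on polynomials in the entries and their conjugates. -/
def polyAvg {N : ℕ} (hN : 0 < N) : MvPolynomial (Entry N) ℂ →ₗ[ℂ] ℂ where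
  toFun P := gaussAvg N fun M => MvPolynomial.eval (entryValue M) P
  map_add' P Q := by
    simp only [gaussAvg, map_add, add_mul]
    rw [integral_add (integrable_polynomial hN P) (integrable_polynomial hN Q), add_div]
  map_smul' a P := by
    simp only [gaussAvg, MvPolynomial.smul_eval, mul_assoc]
    rw [integral_const_mul, mul_div_assoc]
    rfl

theorem polyAvg_one {N : ℕ} (hN : 0 < N) : polyAvg hN 1 = 1 := by
  have hN' : (0 : ℝ) < N := by exact_mod_cast hN
  have h := integral_monomial (N := N) 0
  simp only [MvPolynomial.monomial_zero', map_one, one_mul] at h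
  change gaussAvg N (fun M => MvPolynomial.eval (entryValue M) 1) = 1
  simp only [gaussAvg, map_one, one_mul]
  refine div_self ?_
  rw [h]
  refine Finset.prod_ne_zero_iff.2 fun x _ => ?_
  rw [Finsupp.zero_apply, Finsupp.zero_apply, planeMoment_self hN']
  simp [Real.pi_ne_zero, hN.ne']

/-- Gaussian integration by parts. -/
theorem polyAvg_conj_mul {N : ℕ} (hN : 0 < N) (x : Fin N × Fin N)
    (P : MvPolynomial (Entry N) ℂ) :
    N * polyAvg hN (MvPolynomial.X (.inr x) * P) =
      polyAvg hN (MvPolynomial.pderiv (.inl x) P) := by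
  have hN' : (0 : ℝ) < N := by exact_mod_cast hN
  induction P using MvPolynomial.induction_on' with
  | add P Q hP hQ => rw [mul_add, map_add, map_add, map_add, mul_add, hP, hQ]
  | monomial s a =>
    have hmono (t : Entry N →₀ ℕ) (c : ℂ) : polyAvg hN (MvPolynomial.monomial t c) =
        c * ((∏ y : Fin N × Fin N, planeMoment N (t (.inl y)) (t (.inr y))) /
          ∫ M : Mat N, Complex.exp (-(N : ℂ) * trInv 1 M)) := by
      have : MvPolynomial.monomial t c = c • MvPolynomial.monomial t (1 : ℂ) := by
        rw [MvPolynomial.smul_monomial, smul_eq_mul, mul_one]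
      rw [this, map_smul, smul_eq_mul, ← integral_monomial]
      rfl
    -- Both sides alter exponents only at the entry `x`; its factor is isolated, and
    -- `planeMoment_succ` compares the two versions.
    rw [MvPolynomial.X, MvPolynomial.monomial_mul, one_mul, MvPolynomial.pderiv_monomial, hmono,
      hmono, ← Finset.mul_prod_erase _ _ (Finset.mem_univ x),
      ← Finset.mul_prod_erase _ _ (Finset.mem_univ x)]
    have hl : planeMoment N ((Finsupp.single (.inr x) 1 + s : Entry N →₀ ℕ) (.inl x))
        ((Finsupp.single (.inr x) 1 + s : Entry N →₀ ℕ) (.inr x)) =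
        planeMoment N (s (.inl x)) (s (.inr x) + 1) := by
      simp [add_comm]
    have hr : planeMoment N ((s - Finsupp.single (.inl x) 1 : Entry N →₀ ℕ) (.inl x))
        ((s - Finsupp.single (.inl x) 1 : Entry N →₀ ℕ) (.inr x)) =
        planeMoment N (s (.inl x) - 1) (s (.inr x)) := by
      simp
    have he : ∀ y ∈ Finset.univ.erase x,
        planeMoment N ((Finsupp.single (.inr x) 1 + s : Entry N →₀ ℕ) (.inl y))
          ((Finsupp.single (.inr x) 1 + s : Entry N →₀ ℕ) (.inr y)) =
        planeMoment N ((s - Finsupp.single (.inl x) 1 : Entry N →₀ ℕ) (.inl y))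
          ((s - Finsupp.single (.inl x) 1 : Entry N →₀ ℕ) (.inr y)) := by
      intro y hy
      have hxy : x ≠ y := (Finset.ne_of_mem_erase hy).symm
      simp [hxy]
    rw [Finset.prod_congr rfl he, hl, hr]
    have hs := planeMoment_succ hN' (s (.inl x)) (s (.inr x))
    push_cast at hs
    linear_combination (a * (∏ y ∈ Finset.univ.erase x,
      planeMoment N ((s - Finsupp.single (.inl x) 1 : Entry N →₀ ℕ) (.inl y))
          ((s - Finsupp.single (.inl x) 1 : Entry N →₀ ℕ) (.inr y))) /
          ∫ M : Mat N, Complex.exp (-(N : ℂ) * trInv 1 M)) * hs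

section

/-! ### The polynomials `Tr [(M† M)^p]` and their derivatives -/

theorem derivation_matrix_mul {A R l m n : Type*} [CommRing A] [CommRing R] [Algebra A R]
    [Fintype m] (D : Derivation A R R) (U : Matrix l m R) (V : Matrix m n R) :
    (U * V).map D = U.map D * V + U * V.map D := by
  ext i j
  simp only [Matrix.map_apply, Matrix.add_apply, Matrix.mul_apply, map_sum, Derivation.leibniz,
    smul_eq_mul, ← Finset.sum_add_distrib]
  exact Finset.sum_congr rfl fun _ _ => by ring

theorem derivation_matrix_pow {A R m : Type*} [CommRing A] [CommRing R] [Algebra A R]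
    [Fintype m] [DecidableEq m] (D : Derivation A R R) (U : Matrix m m R) (k : ℕ) :
    (U ^ k).map D = ∑ j ∈ Finset.range k, U ^ j * U.map D * U ^ (k - 1 - j) := by
  induction k with
  | zero =>
    ext i j
    rw [pow_zero, Matrix.map_apply, Matrix.one_apply]
    split_ifs <;> simp
  | succ k ih =>
    rw [pow_succ, derivation_matrix_mul, ih, Finset.sum_range_succ, Finset.sum_mul]
    congr 1
    · refine Finset.sum_congr rfl fun j hj => ?_
      have hj' := Finset.mem_range.1 hj
      rw [mul_assoc, ← pow_succ]
      congr 2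
      omega
    · simp

theorem derivation_prod_pow {A R ι : Type*} [CommRing A] [CommRing R] [Algebra A R]
    [DecidableEq ι] (D : Derivation A R R) (s : Finset ι) (f : ι → R) (n : ι → ℕ) :
    D (∏ k ∈ s, f k ^ n k) =
      ∑ k ∈ s, n k * (∏ j ∈ s, f j ^ (if j = k then n j - 1 else n j)) * D (f k) := by
  induction s using Finset.induction_on with
  | empty => simp
  | insert a s ha ih =>
    rw [Finset.prod_insert ha, Derivation.leibniz, ih, Finset.sum_insert ha,
      Finset.prod_insert ha, if_pos rfl, Derivation.leibniz_pow, add_comm, Finset.smul_sum]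
    congr 1
    · have : ∀ j ∈ s, f j ^ (if j = a then n j - 1 else n j) = f j ^ n j := by
        intro j hj
        rw [if_neg (by rintro rfl; exact ha hj)]
      rw [Finset.prod_congr rfl this]
      simp only [smul_eq_mul, nsmul_eq_mul]
      ring
    · refine Finset.sum_congr rfl fun k hk => ?_
      rw [Finset.prod_insert ha, if_neg (by rintro rfl; exact ha hk), smul_eq_mul]
      ring

/-- The matrix `M` of variables. -/
def varMat (N : ℕ) : Matrix (Fin N) (Fin N) (MvPolynomial (Entry N) ℂ) :=
  Matrix.of fun i j => MvPolynomial.X (.inl (i, j))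

/-- The matrix `M†` of variables. -/
def varMatH (N : ℕ) : Matrix (Fin N) (Fin N) (MvPolynomial (Entry N) ℂ) :=
  Matrix.of fun i j => MvPolynomial.X (.inr (j, i))

/-- The matrix `M† M` of polynomials. -/
def gramMat (N : ℕ) : Matrix (Fin N) (Fin N) (MvPolynomial (Entry N) ℂ) :=
  varMatH N * varMat N

/-- The polynomial `Tr [(M† M)^p]`. -/
def trPoly (N p : ℕ) : MvPolynomial (Entry N) ℂ := (gramMat N ^ p).trace

theorem trPoly_zero (N : ℕ) : trPoly N 0 = (N : MvPolynomial (Entry N) ℂ) := by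
  simp [trPoly]

theorem eval_trPoly {N : ℕ} (p : ℕ) (M : Mat N) :
    MvPolynomial.eval (entryValue M) (trPoly N p) = trInv p M := by
  have hX : (varMat N).map (MvPolynomial.eval (entryValue M)) = Matrix.of M := by
    ext i j
    simp [varMat, entryValue]
  have hY : (varMatH N).map (MvPolynomial.eval (entryValue M)) = (Matrix.of M)ᴴ := by
    ext i j
    simp [varMatH, entryValue]
  rw [trPoly, trInv, AddMonoidHom.map_trace, ← hY, ← hX, gramMat]
  congr 1
  change (MvPolynomial.eval (entryValue M)).mapMatrix _ = _
  rw [map_pow, map_mul]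
  rfl

variable {N : ℕ}

theorem pderiv_varMat (x : Fin N × Fin N) :
    (varMat N).map (MvPolynomial.pderiv (.inl x)) = Matrix.single x.1 x.2 1 := by
  ext i j
  rw [Matrix.map_apply, varMat, Matrix.of_apply, MvPolynomial.pderiv_X, Matrix.single_apply,
    Pi.single_apply]
  simp [Prod.ext_iff, eq_comm]

theorem pderiv_varMatH (x : Fin N × Fin N) :
    (varMatH N).map (MvPolynomial.pderiv (.inl x)) = 0 := by
  ext i j
  rw [Matrix.map_apply, varMatH, Matrix.of_apply, MvPolynomial.pderiv_X]
  simp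

theorem pderiv_gramMat (x : Fin N × Fin N) :
    (gramMat N).map (MvPolynomial.pderiv (.inl x)) = varMatH N * Matrix.single x.1 x.2 1 := by
  rw [gramMat, derivation_matrix_mul, pderiv_varMatH, pderiv_varMat, zero_mul, zero_add]

theorem mul_single_mul_apply {R : Type*} [CommRing R] (U V : Matrix (Fin N) (Fin N) R)
    (a b i j : Fin N) : (U * Matrix.single a b (1 : R) * V) i j = U i a * V b j := by
  rw [mul_assoc, Matrix.mul_apply, Finset.sum_eq_single a]
  · simp
  · intro c _ hc
    simp [Matrix.single_mul_apply_of_ne, hc]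
  · simp

theorem trace_mul_single {R : Type*} [CommRing R] (U : Matrix (Fin N) (Fin N) R)
    (a b : Fin N) : (U * Matrix.single a b 1).trace = U b a := by
  simp [Matrix.trace_mul_single]

/-- By cyclicity of the trace, the `k` Leibniz terms coincide. -/
theorem pderiv_trPoly (x : Fin N × Fin N) (k : ℕ) :
    MvPolynomial.pderiv (.inl x) (trPoly N k) =
      k * (gramMat N ^ (k - 1) * varMatH N) x.2 x.1 := by
  have h : MvPolynomial.pderiv (.inl x) (trPoly N k) =
      ((gramMat N ^ k).map (MvPolynomial.pderiv (.inl x))).trace := by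
    simp [trPoly, Matrix.trace]
  rw [h, derivation_matrix_pow, Matrix.trace_sum, pderiv_gramMat]
  have : ∀ j ∈ Finset.range k, (gramMat N ^ j * (varMatH N * Matrix.single x.1 x.2 1) *
      gramMat N ^ (k - 1 - j)).trace = (gramMat N ^ (k - 1) * varMatH N) x.2 x.1 := by
    intro j hj
    have hj' := Finset.mem_range.1 hj
    rw [Matrix.trace_mul_comm, ← mul_assoc, ← mul_assoc, ← pow_add, trace_mul_single,
      Nat.sub_add_cancel (by omega)]
  rw [Finset.sum_congr rfl this, Finset.sum_const, Finset.card_range, nsmul_eq_mul]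

/-- The divergence of the vector field `M (M† M)^p`. -/
theorem sum_pderiv_mul_pow (p : ℕ) :
    ∑ x : Fin N × Fin N, MvPolynomial.pderiv (.inl x) ((varMat N * gramMat N ^ p) x.1 x.2) =
      ∑ ab ∈ Finset.HasAntidiagonal.antidiagonal p, trPoly N ab.1 * trPoly N ab.2 := by
  have h (x : Fin N × Fin N) :
      (varMat N * gramMat N ^ p).map (MvPolynomial.pderiv (.inl x)) x.1 x.2 =
        (gramMat N ^ p) x.2 x.2 + ∑ j ∈ Finset.range p,
          (varMat N * (gramMat N ^ j * varMatH N)) x.1 x.1 *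
            (gramMat N ^ (p - 1 - j)) x.2 x.2 := by
    rw [derivation_matrix_mul, derivation_matrix_pow, pderiv_gramMat, pderiv_varMat,
      Matrix.add_apply, Finset.mul_sum, Matrix.sum_apply]
    congr 1
    · simp
    · refine Finset.sum_congr rfl fun j _ => ?_
      rw [← mul_single_mul_apply]
      simp only [mul_assoc]
  have htr (j : ℕ) : ∑ i, (varMat N * (gramMat N ^ j * varMatH N)) i i = trPoly N (j + 1) := by
    change (varMat N * (gramMat N ^ j * varMatH N)).trace = _
    rw [Matrix.trace_mul_comm, mul_assoc, trPoly, pow_succ]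
    rfl
  refine (Finset.sum_congr rfl fun x _ => h x).trans ?_
  -- Differentiating the leading `M` gives `N Tr[(M†M)^p]`, which is the `a = 0` term since `Tr 1 =
  -- N`; differentiating the `j`-th Gram factor gives `a = j + 1`.
  rw [Finset.sum_add_distrib, Finset.sum_comm,
    Finset.Nat.sum_antidiagonal_eq_sum_range_succ (fun a b => trPoly N a * trPoly N b),
    Finset.sum_range_succ', add_comm]
  congr 1
  · refine Finset.sum_congr rfl fun j _ => ?_
    rw [Fintype.sum_prod_type]
    dsimp only
    rw [← Finset.sum_mul_sum, htr, Nat.sub_sub, add_comm 1 j]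
    rfl
  · rw [Fintype.sum_prod_type, trPoly_zero, Nat.sub_zero]
    dsimp only
    rw [Finset.sum_const, Finset.card_univ,
      Fintype.card_fin, nsmul_eq_mul]
    rfl

theorem sum_mul_pderiv_trPoly (p k : ℕ) :
    ∑ x : Fin N × Fin N, (varMat N * gramMat N ^ p) x.1 x.2 *
        MvPolynomial.pderiv (.inl x) (trPoly N (k + 1)) =
      (k + 1 : ℕ) * trPoly N (p + (k + 1)) := by
  have hx (x : Fin N × Fin N) : (varMat N * gramMat N ^ p) x.1 x.2 *
      MvPolynomial.pderiv (.inl x) (trPoly N (k + 1)) = (k + 1 : ℕ) *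
        ((varMat N * gramMat N ^ p) x.1 x.2 * (gramMat N ^ k * varMatH N) x.2 x.1) := by
    rw [pderiv_trPoly, Nat.add_sub_cancel, mul_left_comm]
  rw [Finset.sum_congr rfl fun x _ => hx x, ← Finset.mul_sum, Fintype.sum_prod_type]
  refine congrArg _ ?_
  have : ∑ a, ∑ b, (varMat N * gramMat N ^ p) a b * (gramMat N ^ k * varMatH N) b a =
      (varMat N * gramMat N ^ p * (gramMat N ^ k * varMatH N)).trace := by
    simp [Matrix.trace, Matrix.mul_apply]
  rw [this, Matrix.trace_mul_comm, trPoly, ← mul_assoc, mul_assoc _ (varMatH N), add_comm p, pow_add, pow_succ]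
  rfl

theorem sum_conj_mul (p : ℕ) :
    ∑ x : Fin N × Fin N, MvPolynomial.X (.inr x) * (varMat N * gramMat N ^ p) x.1 x.2 =
      trPoly N (p + 1) := by
  rw [Fintype.sum_prod_type_right]
  have : ∑ b, ∑ a, MvPolynomial.X (.inr (a, b)) * (varMat N * gramMat N ^ p) a b =
      (varMatH N * (varMat N * gramMat N ^ p)).trace := by
    simp only [Matrix.trace, Matrix.diag, Matrix.mul_apply (M := varMatH N)]
    rfl
  rw [this, ← mul_assoc, trPoly, pow_succ']
  rfl

/-! ### The loop equations -/

/-- The polynomial `∏_k Tr [(M† M)^k]^n_k`. -/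
def trMonomial (N : ℕ) (n : ℕ+ →₀ ℕ) : MvPolynomial (Entry N) ℂ :=
  n.prod fun k nk => trPoly N k ^ nk

theorem trMonomial_add (m n : ℕ+ →₀ ℕ) :
    trMonomial N (m + n) = trMonomial N m * trMonomial N n :=
  Finsupp.prod_add_index' (by simp) (by simp [pow_add])

theorem trMonomial_single (k : ℕ+) : trMonomial N (Finsupp.single k 1) = trPoly N k := by
  simp [trMonomial]

theorem derivation_trMonomial (D : Derivation ℂ (MvPolynomial (Entry N) ℂ)
    (MvPolynomial (Entry N) ℂ)) (n : ℕ+ →₀ ℕ) :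
    D (trMonomial N n) = ∑ k ∈ n.support,
      (n k : MvPolynomial (Entry N) ℂ) * trMonomial N (n - Finsupp.single k 1) *
        D (trPoly N k) := by
  have hk (k : ℕ+) : trMonomial N (n - Finsupp.single k 1) =
      ∏ j ∈ n.support, trPoly N j ^ (n - Finsupp.single k 1 : ℕ+ →₀ ℕ) j :=
    Finsupp.prod_of_support_subset _
      (fun j hj => by
        simp only [Finsupp.mem_support_iff, Finsupp.tsub_apply] at hj ⊢
        omega) _ (by simp)
  simp_rw [hk]
  rw [trMonomial, Finsupp.prod, derivation_prod_pow]
  refine Finset.sum_congr rfl fun k _ => ?_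
  congr 2
  refine Finset.prod_congr rfl fun j _ => ?_
  rw [Finsupp.tsub_apply, Finsupp.single_apply]
  rcases eq_or_ne k j with rfl | h
  · simp
  · simp [h, h.symm]

/-- The divergence of `V F`, for `V = M (M†M)^p`, is averaged. The divergence of `V` yields the
split traces, its action on `F` the merged ones, and integration by parts turns the average into the
left side. -/
theorem loop_equation (hN : 0 < N) (p : ℕ) (n : ℕ+ →₀ ℕ) :
    N * polyAvg hN (trPoly N (p + 1) * trMonomial N n) =
      ∑ ab ∈ Finset.HasAntidiagonal.antidiagonal p,
        polyAvg hN (trPoly N ab.1 * trPoly N ab.2 * trMonomial N n) +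
      ∑ k ∈ n.support, (n k : ℂ) * (k : ℕ) *
        polyAvg hN (trPoly N (p + k) * trMonomial N (n - Finsupp.single k 1)) := by
  set F := trMonomial N n with hF
  set V : Fin N × Fin N → MvPolynomial (Entry N) ℂ :=
    fun x => (varMat N * gramMat N ^ p) x.1 x.2 with hV
  have hdiv : ∑ x, MvPolynomial.pderiv (.inl x) (V x * F) =
      ∑ ab ∈ Finset.HasAntidiagonal.antidiagonal p, trPoly N ab.1 * trPoly N ab.2 * F +
      ∑ k ∈ n.support, ((n k : ℂ) * (k : ℕ)) •
        (trPoly N (p + k) * trMonomial N (n - Finsupp.single k 1)) := by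
    simp only [Derivation.leibniz, smul_eq_mul, Finset.sum_add_distrib]
    rw [add_comm, ← Finset.mul_sum, ← Finset.sum_mul, hV, sum_pderiv_mul_pow, mul_comm F]
    congr 1
    simp_rw [hF, derivation_trMonomial, Finset.mul_sum]
    rw [Finset.sum_comm]
    refine Finset.sum_congr rfl fun k _ => ?_
    have hk := sum_mul_pderiv_trPoly (N := N) p (k - 1 : ℕ)
    rw [Nat.sub_add_cancel k.pos] at hk
    have hC : (MvPolynomial.C ((n k : ℂ) * (k : ℕ)) : MvPolynomial (Entry N) ℂ) =
        (n k : MvPolynomial (Entry N) ℂ) * ((k : ℕ) : MvPolynomial (Entry N) ℂ) := by simp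
    rw [MvPolynomial.smul_eq_C_mul, hC]
    simp_rw [mul_left_comm _ ((n k : MvPolynomial (Entry N) ℂ) *
      trMonomial N (n - Finsupp.single k 1)), ← Finset.mul_sum]
    rw [hk]
    ring
  have hlhs : N * polyAvg hN (trPoly N (p + 1) * F) =
      ∑ x, polyAvg hN (MvPolynomial.pderiv (.inl x) (V x * F)) := by
    rw [← sum_conj_mul, Finset.sum_mul, map_sum, Finset.mul_sum]
    refine Finset.sum_congr rfl fun x _ => ?_
    rw [mul_assoc, polyAvg_conj_mul]
  rw [hlhs, ← map_sum, hdiv, map_add, map_sum, map_sum]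
  simp only [map_smul, smul_eq_mul]

end

section

/-! ### Reduction to power series in the couplings alone -/

theorem order_add (m n : ℕ+ →₀ ℕ) : order (m + n) = order m + order n :=
  Finsupp.sum_add_index' (by simp) (fun _ _ _ => by ring)

theorem order_single (k : ℕ+) : order (Finsupp.single k 1) = k := by simp [order]

/-- The substitution `g_k ↦ g_k α ^ k`. -/
def graded (f : MvPowerSeries ℕ+ ℂ) : MvPowerSeries Coupling ℂ := fun m =>
  if m none = order m.some then MvPowerSeries.coeff m.some f else 0

theorem coeff_graded (f : MvPowerSeries ℕ+ ℂ) (m : Coupling →₀ ℕ) :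
    MvPowerSeries.coeff m (graded f) =
      if m none = order m.some then MvPowerSeries.coeff m.some f else 0 := rfl

theorem coeff_expo_graded (f : MvPowerSeries ℕ+ ℂ) (n : ℕ+ →₀ ℕ) :
    MvPowerSeries.coeff (expo n) (graded f) = MvPowerSeries.coeff n f := by
  rw [coeff_graded, expo, Finsupp.some_optionElim, Finsupp.optionElim_apply_none, if_pos rfl]

theorem expo_add (m n : ℕ+ →₀ ℕ) : expo (m + n) = expo m + expo n := by
  ext x
  cases x <;> simp [expo, order_add, Finsupp.optionElim_apply_eq_elim]

theorem eq_expo_of_order {m : Coupling →₀ ℕ} (h : m none = order m.some) : m = expo m.some := by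
  rw [expo, ← h, Finsupp.optionElim_some]

theorem some_expo (n : ℕ+ →₀ ℕ) : (expo n).some = n := Finsupp.some_optionElim _ _

/-- The exponents with `m none = order m.some` are the image of the additive injection `expo`. Sums
of two such exponents stay in this set, and on it the nonzero terms of the convolution match those
in the couplings alone. -/
theorem graded_mul (f g : MvPowerSeries ℕ+ ℂ) : graded (f * g) = graded f * graded g := by
  ext m
  rw [coeff_graded, MvPowerSeries.coeff_mul]
  split_ifs with h
  · rw [MvPowerSeries.coeff_mul]
    refine Finset.sum_of_injOn (fun ij => (expo ij.1, expo ij.2)) ?_ ?_ ?_ ?_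
    · rintro ⟨i, j⟩ - ⟨i', j'⟩ - hij
      simp only [Prod.mk.injEq] at hij ⊢
      exact ⟨by rw [← some_expo i, hij.1, some_expo], by rw [← some_expo j, hij.2, some_expo]⟩
    · rintro ⟨i, j⟩ hij
      rw [Finset.mem_coe, Finset.HasAntidiagonal.mem_antidiagonal] at hij ⊢
      dsimp only at hij ⊢
      rw [← expo_add, hij, ← eq_expo_of_order h]
    · rintro ⟨i, j⟩ hij hn
      rw [coeff_graded, coeff_graded]
      by_contra hne
      refine hn ⟨(i.some, j.some), ?_, ?_⟩
      · rw [Finset.HasAntidiagonal.mem_antidiagonal] at hij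
        rw [Finset.mem_coe, Finset.HasAntidiagonal.mem_antidiagonal, ← hij]
        simp
      · have hi : i none = order i.some := by
          by_contra hi
          simp [hi] at hne
        have hj : j none = order j.some := by
          by_contra hj
          simp [hj] at hne
        dsimp only
        rw [← eq_expo_of_order hi, ← eq_expo_of_order hj]
    · rintro ⟨i, j⟩ -
      rw [coeff_expo_graded, coeff_expo_graded]
  · refine (Finset.sum_eq_zero ?_).symm
    rintro ⟨i, j⟩ hij
    replace hij := (@Finset.HasAntidiagonal.mem_antidiagonal _ _ (_) _ _).1 hij
    rw [coeff_graded, coeff_graded]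
    by_contra hne
    refine h ?_
    have hi : i none = order i.some := by
      by_contra hi
      simp [hi] at hne
    have hj : j none = order j.some := by
      by_contra hj
      simp [hj] at hne
    dsimp only at hij
    rw [← hij, Finsupp.some_add, order_add, Finsupp.add_apply, hi, hj]

/-! ### Perturbative series of polynomial observables -/

/-- The combinatorial weight `∏_k (N / k)^n_k / n_k!`. -/
def weight (N : ℕ) (n : ℕ+ →₀ ℕ) : ℂ := n.prod fun k nk => ((N : ℂ) / (k : ℕ)) ^ nk / (nk ! : ℂ)

/-- The factor `n k + 1` is the one produced by `∂/∂g_k`; `N / k` is the coefficient of the source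
in the exponent. -/
theorem weight_add_single (N : ℕ) (n : ℕ+ →₀ ℕ) (k : ℕ+) :
    weight N (n + Finsupp.single k 1) * (n k + 1) = weight N n * (N / (k : ℕ)) := by
  have h1 : weight N (n + Finsupp.single k 1) = ∏ j ∈ insert k n.support,
      ((N : ℂ) / (j : ℕ)) ^ (n + Finsupp.single k 1 : ℕ+ →₀ ℕ) j /
        (((n + Finsupp.single k 1 : ℕ+ →₀ ℕ) j)! : ℂ) :=
    Finsupp.prod_of_support_subset _
      (fun j hj => by
        by_contra hj'
        rw [Finset.mem_insert, Finsupp.mem_support_iff, not_or, not_not] at hj'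
        rw [Finsupp.mem_support_iff, Finsupp.add_apply, hj'.2,
          Finsupp.single_eq_of_ne hj'.1] at hj
        exact hj rfl) _ (by simp)
  have h2 : weight N n = ∏ j ∈ insert k n.support,
      ((N : ℂ) / (j : ℕ)) ^ n j / ((n j)! : ℂ) :=
    Finsupp.prod_of_support_subset _ (Finset.subset_insert _ _) _ (by simp)
  have he : ∀ j ∈ (insert k n.support).erase k,
      ((N : ℂ) / (j : ℕ)) ^ (n + Finsupp.single k 1 : ℕ+ →₀ ℕ) j /
        (((n + Finsupp.single k 1 : ℕ+ →₀ ℕ) j)! : ℂ) =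
      ((N : ℂ) / (j : ℕ)) ^ n j / ((n j)! : ℂ) := by
    intro j hj
    rw [Finsupp.add_apply, Finsupp.single_eq_of_ne (Finset.ne_of_mem_erase hj), add_zero]
  rw [h1, h2, ← Finset.mul_prod_erase _ _ (Finset.mem_insert_self k _),
    ← Finset.mul_prod_erase _ _ (Finset.mem_insert_self k _), Finset.prod_congr rfl he,
    Finsupp.add_apply, Finsupp.single_eq_same, Nat.factorial_succ, pow_succ]
  have hf : ((n k)! : ℂ) ≠ 0 := by exact_mod_cast (n k).factorial_ne_zero
  have hn : ((n k : ℂ) + 1) ≠ 0 := by exact_mod_cast (n k).succ_ne_zero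
  have hk : ((k : ℕ) : ℂ) ≠ 0 := by exact_mod_cast k.ne_zero
  push_cast
  field_simp

theorem weight_sub_single (N : ℕ) {n : ℕ+ →₀ ℕ} {k : ℕ+} (hk : k ∈ n.support) :
    weight N n * (n k * (k : ℕ)) = N * weight N (n - Finsupp.single k 1) := by
  have hnk : 1 ≤ n k := Nat.one_le_iff_ne_zero.2 (Finsupp.mem_support_iff.1 hk)
  have hn : n - Finsupp.single k 1 + Finsupp.single k 1 = n :=
    tsub_add_cancel_of_le (Finsupp.single_le_iff.2 hnk)
  have h := weight_add_single N (n - Finsupp.single k 1) k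
  have hk0 : ((k : ℕ) : ℂ) ≠ 0 := by exact_mod_cast k.ne_zero
  rw [hn, Finsupp.tsub_apply, Finsupp.single_eq_same, Nat.cast_sub hnk, Nat.cast_one,
    sub_add_cancel] at h
  rw [← mul_assoc, h]
  field_simp

variable {N : ℕ} (hN : 0 < N)

/-- The series `⟨P⟩` in the couplings `g_k`, at `α = 1`, of a polynomial observable `P`. -/
def polySeries (P : MvPolynomial (Entry N) ℂ) : MvPowerSeries ℕ+ ℂ := fun n =>
  weight N n * polyAvg hN (P * trMonomial N n)

theorem coeff_polySeries (P : MvPolynomial (Entry N) ℂ) (n : ℕ+ →₀ ℕ) :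
    MvPowerSeries.coeff n (polySeries hN P) = weight N n * polyAvg hN (P * trMonomial N n) := rfl

theorem eval_trMonomial (n : ℕ+ →₀ ℕ) (M : Mat N) :
    MvPolynomial.eval (entryValue M) (trMonomial N n) =
      n.prod fun k nk => trInv (k : ℕ) M ^ nk := by
  simp [trMonomial, Finsupp.prod, map_prod, eval_trPoly]

theorem correlation_eq_graded {O : Mat N → ℂ} {P : MvPolynomial (Entry N) ℂ}
    (h : ∀ M, O M = MvPolynomial.eval (entryValue M) P) :
    correlation N O = graded (polySeries hN P) := by
  ext m
  rw [coeff_graded, coeff_polySeries]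
  change (if m none = order m.some then _ else 0) = _
  refine if_congr Iff.rfl (congrArg₂ (· * ·) rfl ?_) rfl
  change _ = gaussAvg N _
  congr 1
  ext M
  rw [map_mul, ← h, eval_trMonomial]

theorem constantCoeff_polySeries_one : MvPowerSeries.constantCoeff (polySeries hN 1) = 1 := by
  rw [← MvPowerSeries.coeff_zero_eq_constantCoeff_apply, coeff_polySeries, one_mul]
  simp [weight, trMonomial, polyAvg_one]

/-- The normalized series `⟨P⟩ / ⟨1⟩`. -/
def normSeries (P : MvPolynomial (Entry N) ℂ) : MvPowerSeries ℕ+ ℂ :=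
  polySeries hN P * (polySeries hN 1)⁻¹

theorem normSeries_mul (P : MvPolynomial (Entry N) ℂ) :
    normSeries hN P * polySeries hN 1 = polySeries hN P := by
  rw [normSeries, mul_assoc, MvPowerSeries.inv_mul_cancel, mul_one]
  rw [constantCoeff_polySeries_one]
  exact one_ne_zero

theorem dNCoeff_eq (p : ℕ) (n : ℕ+ →₀ ℕ) :
    dNCoeff N p n = 1 / N * MvPowerSeries.coeff n (normSeries hN (trPoly N p)) := by
  have h0 : MvPowerSeries.constantCoeff (graded (polySeries hN 1)) ≠ 0 := by
    rw [← MvPowerSeries.coeff_zero_eq_constantCoeff_apply, coeff_graded]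
    have hz : (0 : Coupling →₀ ℕ).some = 0 := Finsupp.some_zero
    rw [hz, if_pos (by simp [order]), MvPowerSeries.coeff_zero_eq_constantCoeff_apply,
      constantCoeff_polySeries_one]
    exact one_ne_zero
  have h1 : correlation N (fun _ => 1) = graded (polySeries hN 1) :=
    correlation_eq_graded hN fun M => by simp
  have h2 : correlation N (trInv p) = graded (polySeries hN (trPoly N p)) :=
    correlation_eq_graded hN fun M => (eval_trPoly p M).symm
  have h3 : graded (normSeries hN (trPoly N p)) =
      graded (polySeries hN (trPoly N p)) * (graded (polySeries hN 1))⁻¹ := by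
    rw [MvPowerSeries.eq_mul_inv_iff_mul_eq h0, ← graded_mul, normSeries_mul]
  rw [dNCoeff, dN, h1, h2, mul_assoc, mul_comm (graded (polySeries hN 1))⁻¹, ← h3,
    MvPowerSeries.coeff_C_mul, coeff_expo_graded]

theorem normSeries_trPoly_zero : normSeries hN (trPoly N 0) = MvPowerSeries.C (N : ℂ) := by
  have h : polySeries hN (trPoly N 0) = MvPowerSeries.C (N : ℂ) * polySeries hN 1 := by
    ext n
    have : trPoly N 0 * trMonomial N n = (N : ℂ) • (1 * trMonomial N n) := by
      rw [trPoly_zero, MvPolynomial.smul_eq_C_mul, one_mul]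
      simp
    rw [coeff_polySeries, MvPowerSeries.coeff_C_mul, coeff_polySeries, this, map_smul, smul_eq_mul]
    ring
  rw [normSeries, h, mul_assoc, MvPowerSeries.mul_inv_cancel, mul_one]
  rw [constantCoeff_polySeries_one]
  exact one_ne_zero

theorem pderiv_polySeries (k : ℕ+) (P : MvPolynomial (Entry N) ℂ) :
    MvPowerSeries.pderiv ℂ k (polySeries hN P) =
      MvPowerSeries.C ((N : ℂ) / (k : ℕ)) * polySeries hN (trPoly N k * P) := by
  ext n
  rw [MvPowerSeries.coeff_pderiv, MvPowerSeries.coeff_C_mul, coeff_polySeries, coeff_polySeries,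
    mul_right_comm, weight_add_single, trMonomial_add, trMonomial_single]
  have : P * (trMonomial N n * trPoly N k) = trPoly N k * P * trMonomial N n := by ring
  rw [this]
  ring

/-- Derivatives of `⟨Tr [(M† M)^p]⟩ / ⟨1⟩` are connected two-trace correlations. -/
theorem pderiv_normSeries (k : ℕ+) (p : ℕ) :
    MvPowerSeries.pderiv ℂ k (normSeries hN (trPoly N p)) =
      MvPowerSeries.C ((N : ℂ) / (k : ℕ)) * (normSeries hN (trPoly N k * trPoly N p) -
        normSeries hN (trPoly N k) * normSeries hN (trPoly N p)) := by
  have h0 : MvPowerSeries.constantCoeff (polySeries hN 1) ≠ 0 := by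
    rw [constantCoeff_polySeries_one]
    exact one_ne_zero
  -- The product rule is applied to `normSeries * ⟨1⟩ = ⟨P⟩`, which avoids differentiating an
  -- inverse.
  have h := congrArg (MvPowerSeries.pderiv ℂ k) (normSeries_mul hN (trPoly N p))
  rw [Derivation.leibniz, pderiv_polySeries, pderiv_polySeries, mul_one, smul_eq_mul,
    smul_eq_mul] at h
  have hinv := MvPowerSeries.mul_inv_cancel _ h0
  have h' := congrArg (· * (polySeries hN 1)⁻¹) h
  simp only [normSeries] at h' ⊢
  linear_combination h' - MvPowerSeries.pderiv ℂ k
    (polySeries hN (trPoly N p) * (polySeries hN 1)⁻¹) * hinv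

/-- Both sides equal `N` times a coefficient of the same connected two-trace correlation. -/
theorem mul_coeff_normSeries_symm (p q : ℕ+) (n : ℕ+ →₀ ℕ) :
    (q : ℕ) * ((n q + 1) * MvPowerSeries.coeff (n + Finsupp.single q 1)
        (normSeries hN (trPoly N p))) =
      (p : ℕ) * ((n p + 1) * MvPowerSeries.coeff (n + Finsupp.single p 1)
        (normSeries hN (trPoly N q))) := by
  have key (a b : ℕ+) : (b : ℕ) * ((n b + 1) * MvPowerSeries.coeff (n + Finsupp.single b 1)
        (normSeries hN (trPoly N a))) = N * MvPowerSeries.coeff n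
          (normSeries hN (trPoly N b * trPoly N a) -
            normSeries hN (trPoly N b) * normSeries hN (trPoly N a)) := by
    have h := congrArg (MvPowerSeries.coeff n) (pderiv_normSeries hN b a)
    rw [MvPowerSeries.coeff_pderiv, MvPowerSeries.coeff_C_mul] at h
    have hb : ((b : ℕ) : ℂ) ≠ 0 := by exact_mod_cast b.ne_zero
    rw [mul_comm ((n b : ℂ) + 1), h]
    field_simp
  rw [key, key, mul_comm (trPoly N q), mul_comm (normSeries hN (trPoly N q))]

/-! ### Loop equations for the coefficients -/

/-- Needed because the loop equation is used with its sum over couplings cut to `n.support`, so that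
the two series agree only in degrees `≤ n`. -/
theorem coeff_mul_congr {σ : Type*} {f g : MvPowerSeries σ ℂ} {n : σ →₀ ℕ}
    (h : ∀ m ≤ n, MvPowerSeries.coeff m f = MvPowerSeries.coeff m g) (e : MvPowerSeries σ ℂ) :
    MvPowerSeries.coeff n (f * e) = MvPowerSeries.coeff n (g * e) := by
  classical
  rw [MvPowerSeries.coeff_mul, MvPowerSeries.coeff_mul]
  refine Finset.sum_congr rfl fun ij hij => ?_
  rw [h ij.1 (by rw [← Finset.HasAntidiagonal.mem_antidiagonal.1 hij]; exact le_self_add)]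

theorem coeff_X_mul_sum {s : Finset ℕ+} {n : ℕ+ →₀ ℕ} (hs : n.support ⊆ s)
    (f : ℕ+ → MvPowerSeries ℕ+ ℂ) :
    MvPowerSeries.coeff n (∑ k ∈ s, MvPowerSeries.X k * f k) =
      ∑ k ∈ n.support, MvPowerSeries.coeff (n - Finsupp.single k 1) (f k) := by
  rw [map_sum]
  have h (k : ℕ+) : MvPowerSeries.coeff n (MvPowerSeries.X k * f k) =
      if k ∈ n.support then MvPowerSeries.coeff (n - Finsupp.single k 1) (f k) else 0 := by
    rw [MvPowerSeries.X, MvPowerSeries.coeff_monomial_mul, one_mul]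
    refine if_congr ?_ rfl rfl
    rw [Finsupp.single_le_iff, Nat.one_le_iff_ne_zero, Finsupp.mem_support_iff]
  simp_rw [h]
  rw [← Finset.sum_filter, Finset.filter_mem_eq_inter, Finset.inter_eq_right.2 hs]

theorem coeff_loop_equation (p : ℕ) (n : ℕ+ →₀ ℕ) :
    N * MvPowerSeries.coeff n (polySeries hN (trPoly N (p + 1))) =
      ∑ ab ∈ Finset.HasAntidiagonal.antidiagonal p,
        MvPowerSeries.coeff n (polySeries hN (trPoly N ab.1 * trPoly N ab.2)) +
      N * ∑ k ∈ n.support, MvPowerSeries.coeff (n - Finsupp.single k 1)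
        (polySeries hN (trPoly N (p + k))) := by
  simp_rw [coeff_polySeries]
  rw [mul_left_comm, loop_equation, mul_add, Finset.mul_sum, Finset.mul_sum, Finset.mul_sum]
  congr 1
  refine Finset.sum_congr rfl fun k hk => ?_
  rw [← mul_assoc, weight_sub_single N hk]
  ring

theorem coeff_normSeries_loop (p : ℕ) (n : ℕ+ →₀ ℕ) :
    N * MvPowerSeries.coeff n (normSeries hN (trPoly N (p + 1))) =
      ∑ ab ∈ Finset.HasAntidiagonal.antidiagonal p,
        MvPowerSeries.coeff n (normSeries hN (trPoly N ab.1 * trPoly N ab.2)) +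
      N * ∑ k ∈ n.support, MvPowerSeries.coeff (n - Finsupp.single k 1)
        (normSeries hN (trPoly N (p + k))) := by
  have h : ∀ m ≤ n, MvPowerSeries.coeff m
      (MvPowerSeries.C (N : ℂ) * polySeries hN (trPoly N (p + 1))) =
      MvPowerSeries.coeff m (∑ ab ∈ Finset.HasAntidiagonal.antidiagonal p,
        polySeries hN (trPoly N ab.1 * trPoly N ab.2) + MvPowerSeries.C (N : ℂ) *
        ∑ k ∈ n.support, MvPowerSeries.X k * polySeries hN (trPoly N (p + k))) := by
    intro m hm
    rw [MvPowerSeries.coeff_C_mul, coeff_loop_equation, map_add, MvPowerSeries.coeff_C_mul,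
      coeff_X_mul_sum (Finsupp.support_mono hm), map_sum]
  have h' := coeff_mul_congr h (polySeries hN 1)⁻¹
  rw [mul_assoc, MvPowerSeries.coeff_C_mul, add_mul, Finset.sum_mul, mul_assoc, Finset.sum_mul,
    map_add, map_sum, MvPowerSeries.coeff_C_mul] at h'
  simp_rw [mul_assoc] at h'
  rw [coeff_X_mul_sum subset_rfl] at h'
  exact h'

/-- This is `pderiv_normSeries` solved for the two-trace term. There is no coupling `g_0`, but for
`b = 0` the trace is the constant `N` and the correlation factorizes. -/
theorem coeff_normSeries_mul (a b : ℕ) (n : ℕ+ →₀ ℕ) :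
    MvPowerSeries.coeff n (normSeries hN (trPoly N a * trPoly N b)) =
      ∑ ij ∈ Finset.HasAntidiagonal.antidiagonal n,
        MvPowerSeries.coeff ij.1 (normSeries hN (trPoly N a)) *
          MvPowerSeries.coeff ij.2 (normSeries hN (trPoly N b)) +
      if h : 0 < b then b / N * ((n (b.toPNat h) + 1) *
        MvPowerSeries.coeff (n + Finsupp.single (b.toPNat h) 1) (normSeries hN (trPoly N a))) else 0 := by
  have hN0 : (N : ℂ) ≠ 0 := by exact_mod_cast hN.ne'
  rw [← MvPowerSeries.coeff_mul]
  split_ifs with h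
  · have hb : (b : ℂ) ≠ 0 := by exact_mod_cast h.ne'
    have hd := congrArg (MvPowerSeries.coeff n) (pderiv_normSeries hN (b.toPNat h) a)
    have hc : ((b.toPNat h : ℕ+) : ℕ) = b := rfl
    rw [MvPowerSeries.coeff_pderiv, MvPowerSeries.coeff_C_mul, map_sub, hc,
      mul_comm (trPoly N b), mul_comm (normSeries hN (trPoly N b))] at hd
    rw [mul_comm ((n (b.toPNat h) : ℂ) + 1), hd]
    field_simp
    ring
  · obtain rfl : b = 0 := by omega
    rw [add_zero, normSeries_trPoly_zero, MvPowerSeries.coeff_mul_C]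
    have hs : polySeries hN (trPoly N a * trPoly N 0) =
        polySeries hN (trPoly N a) * MvPowerSeries.C (N : ℂ) := by
      ext m
      have : trPoly N a * trPoly N 0 * trMonomial N m =
          (N : ℂ) • (trPoly N a * trMonomial N m) := by
        rw [trPoly_zero, MvPolynomial.smul_eq_C_mul, MvPolynomial.C_eq_coe_nat]
        ring
      rw [coeff_polySeries, MvPowerSeries.coeff_mul_C, coeff_polySeries, this, map_smul,
        smul_eq_mul]
      ring
    rw [normSeries, hs, mul_right_comm, MvPowerSeries.coeff_mul_C]
    rfl

/-- The recursion that determines the coefficients of `d_{p;(N)}`. -/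
theorem dNCoeff_succ {N : ℕ} (hN : 0 < N) (p : ℕ) (n : ℕ+ →₀ ℕ) :
    dNCoeff N (p + 1) n =
      ∑ ab ∈ Finset.HasAntidiagonal.antidiagonal p,
        (∑ ij ∈ Finset.HasAntidiagonal.antidiagonal n,
            dNCoeff N ab.1 ij.1 * dNCoeff N ab.2 ij.2 +
          1 / (N : ℂ) ^ 2 * if h : 0 < ab.2 then ab.2 * ((n (ab.2.toPNat h) + 1) *
            dNCoeff N ab.1 (n + Finsupp.single (ab.2.toPNat h) 1)) else 0) +
      ∑ k ∈ n.support, dNCoeff N (p + k) (n - Finsupp.single k 1) := by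
  have hN0 : (N : ℂ) ≠ 0 := by exact_mod_cast hN.ne'
  have h := coeff_normSeries_loop hN p n
  -- Dividing by `N²` gives each of the two traces in a product its `1/N`; the connected part,
  -- already carrying `b / N`, is left with `1/N²`.
  have h1 : dNCoeff N (p + 1) n = 1 / (N : ℂ) ^ 2 *
      (N * MvPowerSeries.coeff n (normSeries hN (trPoly N (p + 1)))) := by
    rw [dNCoeff_eq hN]
    field_simp
  rw [h1, h, mul_add, Finset.mul_sum]
  congr 1
  · refine Finset.sum_congr rfl fun ab _ => ?_
    rw [coeff_normSeries_mul, mul_add, Finset.mul_sum]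
    congr 1
    · refine Finset.sum_congr rfl fun ij _ => ?_
      rw [dNCoeff_eq hN, dNCoeff_eq hN]
      ring
    · split_ifs with hb
      · rw [dNCoeff_eq hN]
        ring
      · rfl
  · rw [← mul_assoc, Finset.mul_sum]
    refine Finset.sum_congr rfl fun k _ => ?_
    rw [dNCoeff_eq hN]
    field_simp

theorem dNCoeff_zero {N : ℕ} (hN : 0 < N) (n : ℕ+ →₀ ℕ) : dNCoeff N 0 n = if n = 0 then 1 else 0 := by
  classical
  have hN0 : (N : ℂ) ≠ 0 := by exact_mod_cast hN.ne'
  rw [dNCoeff_eq hN, normSeries_trPoly_zero, MvPowerSeries.coeff_C]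
  split_ifs <;> simp [hN0]

/-! ### The planar limit -/

/-- In the recursion for `p + 1`, the merged and the `1/N²` terms have `p + order n` as their total:
the change in `order` compensates the change in the trace power. Each factor of a product has at
most that total. The `1/N²` terms thus have convergent coefficients and vanish in the limit. -/
theorem exists_tendsto_dNCoeff (p : ℕ) (n : ℕ+ →₀ ℕ) :
    ∃ l, Tendsto (fun N : ℕ => dNCoeff N p n) atTop (𝓝 l) := by
  induction hd : p + order n using Nat.strong_induction_on generalizing p n with
  | _ d ih =>
    rcases p with _ | p
    · refine ⟨if n = 0 then 1 else 0, tendsto_const_nhds.congr' ?_⟩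
      filter_upwards [eventually_gt_atTop 0] with N hN
      rw [dNCoeff_zero hN]
    · have hlim (q : ℕ) (m : ℕ+ →₀ ℕ) (h : q + order m < d) :
          ∃ l, Tendsto (fun N : ℕ => dNCoeff N q m) atTop (𝓝 l) := ih _ h q m rfl
      have hsum {ι : Type} (s : Finset ι) (f : ι → ℕ → ℂ)
          (h : ∀ i ∈ s, ∃ l, Tendsto (f i) atTop (𝓝 l)) :
          ∃ l, Tendsto (fun N => ∑ i ∈ s, f i N) atTop (𝓝 l) := by
        choose! l hl using h
        exact ⟨_, tendsto_finsetSum s hl⟩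
      have hzero : Tendsto (fun N : ℕ => 1 / (N : ℂ) ^ 2) atTop (𝓝 0) := by
        have h := (tendsto_inv_atTop_nhds_zero_nat (𝕜 := ℂ)).pow 2
        simpa using h
      have hA (ab : ℕ × ℕ) (hab : ab ∈ Finset.HasAntidiagonal.antidiagonal p) :
          ∃ l, Tendsto (fun N : ℕ => ∑ ij ∈ Finset.HasAntidiagonal.antidiagonal n,
              dNCoeff N ab.1 ij.1 * dNCoeff N ab.2 ij.2 +
            1 / (N : ℂ) ^ 2 * if h : 0 < ab.2 then ab.2 * ((n (ab.2.toPNat h) + 1) *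
              dNCoeff N ab.1 (n + Finsupp.single (ab.2.toPNat h) 1)) else 0) atTop (𝓝 l) := by
        have hab' := Finset.HasAntidiagonal.mem_antidiagonal.1 hab
        obtain ⟨l₁, h₁⟩ := hsum (Finset.HasAntidiagonal.antidiagonal n)
          (fun ij N => dNCoeff N ab.1 ij.1 * dNCoeff N ab.2 ij.2) fun ij hij => by
            have ho := congrArg order (Finset.HasAntidiagonal.mem_antidiagonal.1 hij)
            rw [order_add] at ho
            obtain ⟨l, hl⟩ := hlim ab.1 ij.1 (by omega)
            obtain ⟨l', hl'⟩ := hlim ab.2 ij.2 (by omega)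
            exact ⟨_, hl.mul hl'⟩
        by_cases hb : 0 < ab.2
        · obtain ⟨l₂, h₂⟩ := hlim ab.1 (n + Finsupp.single (ab.2.toPNat hb) 1) (by
            have hc : ((ab.2.toPNat hb : ℕ+) : ℕ) = ab.2 := rfl
            rw [order_add, order_single, hc]
            omega)
          simp only [dif_pos hb]
          exact ⟨_, h₁.add (hzero.mul ((h₂.const_mul _).const_mul _))⟩
        · simp only [dif_neg hb, mul_zero, add_zero]
          exact ⟨_, h₁⟩
      obtain ⟨l₁, h₁⟩ := hsum _ _ hA
      obtain ⟨l₂, h₂⟩ := hsum n.support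
        (fun k N => dNCoeff N (p + k) (n - Finsupp.single k 1)) fun k hk => by
          have hn : n - Finsupp.single k 1 + Finsupp.single k 1 = n :=
            tsub_add_cancel_of_le (Finsupp.single_le_iff.2
              (Nat.one_le_iff_ne_zero.2 (Finsupp.mem_support_iff.1 hk)))
          have ho := congrArg order hn
          rw [order_add, order_single] at ho
          exact hlim _ _ (by omega)
      refine ⟨l₁ + l₂, (h₁.add h₂).congr' ?_⟩
      filter_upwards [eventually_gt_atTop 0] with N hN
      rw [dNCoeff_succ hN]

/-- `limUnder` takes an arbitrary value when no limit exists, so existence has to come first. -/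
theorem tendsto_dNCoeff (p : ℕ) (n : ℕ+ →₀ ℕ) :
    Tendsto (fun N : ℕ => dNCoeff N p n) atTop (𝓝 (dCoeff p n)) :=
  tendsto_nhds_limUnder (exists_tendsto_dNCoeff p n)

theorem dNCoeff_symm {N : ℕ} (hN : 0 < N) (p q : ℕ+) (n : ℕ+ →₀ ℕ) :
    1 / ((p : ℕ) : ℂ) * (1 / ((n p : ℂ) + 1)) * dNCoeff N p (n + Finsupp.single q 1) =
      1 / ((q : ℕ) : ℂ) * (1 / ((n q : ℂ) + 1)) * dNCoeff N q (n + Finsupp.single p 1) := by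
  have h := mul_coeff_normSeries_symm hN p q n
  have hp : ((p : ℕ) : ℂ) ≠ 0 := by exact_mod_cast p.ne_zero
  have hq : ((q : ℕ) : ℂ) ≠ 0 := by exact_mod_cast q.ne_zero
  have hnp : ((n p : ℂ) + 1) ≠ 0 := by exact_mod_cast (n p).succ_ne_zero
  have hnq : ((n q : ℂ) + 1) ≠ 0 := by exact_mod_cast (n q).succ_ne_zero
  have hN0 : (N : ℂ) ≠ 0 := by exact_mod_cast hN.ne'
  rw [dNCoeff_eq hN, dNCoeff_eq hN]
  field_simp
  linear_combination h

end

end MatrixModel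

end

theorem mainTheorem4 :
    (∀ (p : ℕ) (n : ℕ+ →₀ ℕ),
      Tendsto (fun N : ℕ => MatrixModel.dNCoeff N p n) atTop (𝓝 (MatrixModel.dCoeff p n))) ∧
    ∀ (p q : ℕ+) (n : ℕ+ →₀ ℕ),
      1 / ((p : ℕ) : ℂ) * (1 / ((n p : ℂ) + 1)) *
          MatrixModel.dCoeff (p : ℕ) (n + Finsupp.single q 1) =
        1 / ((q : ℕ) : ℂ) * (1 / ((n q : ℂ) + 1)) *
          MatrixModel.dCoeff (q : ℕ) (n + Finsupp.single p 1) := by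
  refine ⟨MatrixModel.tendsto_dNCoeff, fun p q n => ?_⟩
  -- The two sides are limits of sequences that agree for all `N > 0`.
  refine tendsto_nhds_unique_of_eventuallyEq
    ((MatrixModel.tendsto_dNCoeff p (n + Finsupp.single q 1)).const_mul _)
    ((MatrixModel.tendsto_dNCoeff q (n + Finsupp.single p 1)).const_mul _) ?_
  filter_upwards [eventually_gt_atTop 0] with N hN
  exact MatrixModel.dNCoeff_symm hN p q n
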